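/- Let $n,m,p\ge 0$. An affine control system with $n$ states, $m$ inputs and $p$ outputs is given by $x_{k+1}=\bar A x_k+\bar B u_k+\bar c$, $y_k=\bar C x_k+\bar d$ over $\mathbb R$; lifting affine maps to linear maps by appending a coordinate equal to $1$, it is the triple $$\Sigma=(A,B,C),\qquad A=\begin{bmatrix}\bar A&\bar c\\0&1\end{bmatrix},\quad B=\begin{bmatrix}\bar B\\0\end{bmatrix},\quad C=\begin{bmatrix}\bar C&\bar d\\0&1\end{bmatrix}.$$ Let $\mathcal S_{n,m,p}$ be the set of those systems for which $(\bar A,\bar B)$ is controllable and $(\bar A,\bar C)$ is observable. Let $\mathcal G_{n,m,p}$ be the Lie group of quadruples $\psi=(P,F,G,S)$, where $P:\mathbb R^n\to\mathbb R^n$ and $S:\mathbb R^p\to\mathbb R^p$ are invertible affine maps, $F:\mathbb R^n\to\mathbb R^m$ is an affine map and $G:\mathbb R^m\to\mathbb R^m$ is an invertible linear map (affine maps being lifted: $P$ and $S$ are square matrices of size $n+1$ and $p+1$ with last row $(0,\dots,0,1)$, and $F$ is an $m\times(n+1)$ matrix), with composition $\psi_2\circ\psi_1=(P_2P_1,\,G_2F_1+F_2P_1,\,G_2G_1,\,S_2S_1)$.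 It acts on systems by $$\psi_*\Sigma=(P(A-BG^{-1}F)P^{-1},\;PBG^{-1},\;SCP^{-1}),$$ and two systems are equivalent if some $\psi\in\mathcal G_{n,m,p}$ maps one to the other. The symmetry group of $\Sigma$ is the subgroup $\mathcal K_{n,m,p}(\Sigma)=\{\psi\in\mathcal G_{n,m,p}:\psi_*\Sigma=\Sigma\}$. For a pair $(A,B)$ put $$r_1=\operatorname{rank}B,\qquad r_i=\operatorname{rank}S_{i-1}(A,B)-\operatorname{rank}S_{i-2}(A,B)\quad(i\ge 2),\qquad S_j(A,B)=\begin{bmatrix}B&AB&\cdots&A^jB\end{bmatrix},$$ and let $\kappa_1\ge\dots\ge\kappa_m$ be the controllability indices of $(A,B)$, $\kappa_i=\#\{j\ge 1: r_j\ge i\}$. A system is prime if it is equivalent to a system of the chain form $$x^{(i,1)}_{k+1}=x^{(i,2)}_k,\;\dots,\;x^{(i,\kappa_i-1)}_{k+1}=x^{(i,\kappa_i)}_k,\quad x^{(i,\kappa_i)}_{k+1}=u^{(i)}_k,\quad y^{(i)}_k=x^{(i,1)}_k,\qquad 1\le i\le m,$$ with state $x=(x^{(1,1)},\dots,x^{(1,\kappa_1)},\dots,x^{(m,1)},\dots,x^{(m,\kappa_m)})\in\mathbb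 R^n$ (so $p=m$ and all $\kappa_i\ge1$), where $\kappa_1,\dots,\kappa_m$ are its controllability indices. If $\Sigma=(A,B,C)\in\mathcal S_{n,m,p}$ is a prime system, then $\mathcal K_{n,m,p}(\Sigma)$, with the smooth structure of an embedded Lie subgroup of $\mathcal G_{n,m,p}$, is a Lie group of dimension $$\dim\mathcal K_{n,m,p}(\Sigma)=\sum_{i=1}^m r_{\kappa_i}+m,$$ where the $r_i$ and the $\kappa_i$ are those of $(A,B)$. -/

import Mathlib

open scoped Matrix Manifold ContDiff

noncomputable section

namespace PrimeSystem

/-- Index type of the lifted space: `ℝⁿ` together with one extra coordinate, which is always `1`. -/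
abbrev Lift (n : ℕ) : Type := Fin n ⊕ Unit

/-- The lift of a vector `x ∈ ℝⁿ`, namely `(x, 1)`. -/
def liftVec {n : ℕ} (x : Fin n → ℝ) : Lift n → ℝ := Sum.elim x fun _ => 1

/-- A matrix is the lift `[W v; 0 1]` of an affine map `x ↦ W x + v` iff its last row is
`(0, …, 0, 1)`. -/
def IsLift {k n : ℕ} (M : Matrix (Lift k) (Lift n) ℝ) : Prop :=
  M (Sum.inr ()) = Pi.single (Sum.inr ()) 1

theorem IsLift.mul {k l n : ℕ} {M : Matrix (Lift k) (Lift l) ℝ} {N : Matrix (Lift l) (Lift n) ℝ}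
    (hM : IsLift M) (hN : IsLift N) : IsLift (M * N) := by
  unfold IsLift at *
  rw [← hN]
  ext j
  rw [Matrix.mul_apply, hM]
  simp [Pi.single_apply]

theorem isLift_one (n : ℕ) : IsLift (1 : Matrix (Lift n) (Lift n) ℝ) := by
  unfold IsLift
  ext j
  simp [Matrix.one_apply, Pi.single_apply, eq_comm]

/-- The group of invertible affine maps `ℝⁿ → ℝⁿ`, in lifted form. -/
def affineGL (n : ℕ) : Subgroup (GL (Lift n) ℝ) where
  carrier := {P | IsLift (P : Matrix (Lift n) (Lift n) ℝ)}
  mul_mem' := fun ha hb => IsLift.mul ha hb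
  one_mem' := isLift_one n
  inv_mem' := by
    intro P hP
    change IsLift ((P⁻¹ : GL (Lift n) ℝ) : Matrix (Lift n) (Lift n) ℝ)
    have h : (P : Matrix (Lift n) (Lift n) ℝ) * ((P⁻¹ : GL (Lift n) ℝ) : Matrix _ _ ℝ) = 1 :=
      P.mul_inv
    have h1 : IsLift ((P : Matrix (Lift n) (Lift n) ℝ) * ((P⁻¹ : GL (Lift n) ℝ) :
      Matrix _ _ ℝ)) := by rw [h]; exact isLift_one n
    unfold IsLift at h1
    change IsLift (P : Matrix (Lift n) (Lift n) ℝ) at hP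
    unfold IsLift at hP ⊢
    rw [← h1]
    ext j
    rw [Matrix.mul_apply, hP]
    simp [Pi.single_apply]

/-! ### Control systems -/

/-- An affine control system `x⁺ = Ā x + B̄ u + c̄`, `y = C̄ x + d̄` with `n` states, `m` inputs and
`p` outputs, given by its lifted matrices `A = [Ā c̄; 0 1]`, `B = [B̄; 0]`, `C = [C̄ d̄; 0 1]`. -/
@[ext]
structure ControlSystem (n m p : ℕ) where
  A : Matrix (Lift n) (Lift n) ℝ
  B : Matrix (Lift n) (Fin m) ℝ
  C : Matrix (Lift p) (Lift n) ℝ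
  isLift_A : IsLift A
  lastRow_B : B (Sum.inr ()) = 0
  isLift_C : IsLift C

/-- The matrix `[B AB … AʲB]`, with `j + 1` blocks. -/
def reachMatrix {N : Type} [Fintype N] [DecidableEq N] {m : ℕ}
    (A : Matrix N N ℝ) (B : Matrix N (Fin m) ℝ) (j : ℕ) : Matrix N (Fin (j + 1) × Fin m) ℝ :=
  Matrix.of fun a kl => (A ^ (kl.1 : ℕ) * B) a kl.2

/-- The rank increments `r₁ = rank B` and `rᵢ = rank [B … Aⁱ⁻¹B] - rank [B … Aⁱ⁻²B]` for `i ≥ 2`.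
(The ranks do not decrease with `i`, so the subtraction does not truncate; `r₀ = 0` is not used.) -/
def rankIncr {N : Type} [Fintype N] [DecidableEq N] {m : ℕ}
    (A : Matrix N N ℝ) (B : Matrix N (Fin m) ℝ) : ℕ → ℕ
  | 0 => 0
  | 1 => B.rank
  | i + 2 => (reachMatrix A B (i + 1)).rank - (reachMatrix A B i).rank

/-- The controllability indices `κ₁ ≥ … ≥ κₘ` of the pair `(A, B)`: `κᵢ` is the number of `j ≥ 1`
with `rⱼ ≥ i`. The `i`-th index is the value at the element of `Fin m` whose underlying number is
`i - 1`. (All `rⱼ` with `j` larger than the size of `A` vanish.) -/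
def ctrlIndex {N : Type} [Fintype N] [DecidableEq N] {m : ℕ}
    (A : Matrix N N ℝ) (B : Matrix N (Fin m) ℝ) (i : Fin m) : ℕ :=
  ((Finset.Icc 1 (Fintype.card N)).filter fun j => (i : ℕ) + 1 ≤ rankIncr A B j).card

namespace ControlSystem

variable {n m p : ℕ}

/-- `rank [B̄ ĀB̄ … Āⁿ⁻¹B̄] = n`. -/
def IsControllable (sys : ControlSystem n m p) : Prop :=
  (reachMatrix sys.A.toBlocks₁₁ sys.B.toRows₁ (n - 1)).rank = n

/-- The matrix with blocks `C̄, C̄Ā, …, C̄Āⁿ⁻¹` stacked on top of each other has rank `n`. -/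
def IsObservable (sys : ControlSystem n m p) : Prop :=
  (Matrix.of fun (kl : Fin (n - 1 + 1) × Fin p) (a : Fin n) =>
    (sys.C.toBlocks₁₁ * sys.A.toBlocks₁₁ ^ (kl.1 : ℕ)) kl.2 a).rank = n

/-- The system consists of `m` chains of integrators of lengths `κ₁, …, κₘ ≥ 1`,
`x⁽ⁱʲ⁾⁺ = x⁽ⁱʲ⁺¹⁾` for `j < κᵢ` and `x⁽ⁱ,κᵢ⁾⁺ = u⁽ⁱ⁾`, and its outputs are the first states of the
chains, `y⁽ⁱ⁾ = x⁽ⁱ¹⁾` for `1 ≤ i ≤ m`. The states are ordered lexicographically. -/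
def IsChainForm (sys : ControlSystem n m p) (κ : Fin m → ℕ) : Prop :=
  ∃ (hp : m = p) (hn : ∑ i, κ i = n) (hκ : ∀ i, 0 < κ i),
    let e : (Σ i : Fin m, Fin (κ i)) ≃ Fin n := finSigmaFinEquiv.trans (finCongr hn)
    (∀ (x : Fin n → ℝ) (u : Fin m → ℝ) (i : Fin m) (j : Fin (κ i)),
      (sys.A *ᵥ liftVec x + sys.B *ᵥ u) (Sum.inl (e ⟨i, j⟩)) =
        if h : (j : ℕ) + 1 < κ i then x (e ⟨i, ⟨j + 1, h⟩⟩) else u i) ∧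
    (∀ (x : Fin n → ℝ) (i : Fin m),
      (sys.C *ᵥ liftVec x) (Sum.inl (Fin.cast hp i)) = x (e ⟨i, ⟨0, hκ i⟩⟩))

end ControlSystem

/-! ### Isomorphisms and their action -/

/-- An isomorphism `(P, F, G, S)`: `P` and `S` are invertible affine maps (lifted), `F` is an affine
map `ℝⁿ → ℝᵐ`, written as the `m × (n + 1)` matrix acting on lifted states, and `G` is an
invertible linear map. -/
@[ext]
structure SystemIso (n m p : ℕ) where
  P : affineGL n
  F : Matrix (Fin m) (Lift n) ℝ
  G : GL (Fin m) ℝ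
  S : affineGL p

namespace SystemIso

variable {n m p : ℕ}

instance : Mul (SystemIso n m p) where
  mul ψ₂ ψ₁ := ⟨ψ₂.P * ψ₁.P, ψ₂.G.val * ψ₁.F + ψ₂.F * ψ₁.P.1.val, ψ₂.G * ψ₁.G, ψ₂.S * ψ₁.S⟩

instance : One (SystemIso n m p) where
  one := ⟨1, 0, 1, 1⟩

instance : Inv (SystemIso n m p) where
  inv ψ := ⟨ψ.P⁻¹, -((ψ.G⁻¹).val * ψ.F * (ψ.P⁻¹).1.val), ψ.G⁻¹, ψ.S⁻¹⟩

theorem mul_def (ψ₂ ψ₁ : SystemIso n m p) : ψ₂ * ψ₁ =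
    ⟨ψ₂.P * ψ₁.P, ψ₂.G.val * ψ₁.F + ψ₂.F * ψ₁.P.1.val, ψ₂.G * ψ₁.G, ψ₂.S * ψ₁.S⟩ := rfl

theorem one_def : (1 : SystemIso n m p) = ⟨1, 0, 1, 1⟩ := rfl

theorem inv_def (ψ : SystemIso n m p) :
    ψ⁻¹ = ⟨ψ.P⁻¹, -((ψ.G⁻¹).val * ψ.F * (ψ.P⁻¹).1.val), ψ.G⁻¹, ψ.S⁻¹⟩ := rfl

/-- The group of isomorphisms, under composition. -/
instance : Group (SystemIso n m p) where
  mul_assoc a b c := by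
    simp only [mul_def, mk.injEq, mul_assoc, true_and, and_true]
    simp [Matrix.mul_add, Matrix.add_mul, Matrix.mul_assoc, add_assoc]
  one_mul a := by
    simp only [mul_def, one_def, one_mul]
    ext1 <;> simp
  mul_one a := by
    simp only [mul_def, one_def, mul_one]
    ext1 <;> simp
  inv_mul_cancel a := by
    have h : (a.P⁻¹).1.val * a.P.1.val = 1 := (a.P : GL (Lift n) ℝ).inv_mul
    simp only [mul_def, one_def, inv_def, inv_mul_cancel, mk.injEq, true_and, and_true]
    rw [Matrix.neg_mul, Matrix.mul_assoc _ _ a.P.1.val, h, Matrix.mul_one, add_neg_cancel]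

/-- The action `(P(A - BG⁻¹F)P⁻¹, PBG⁻¹, SCP⁻¹)` of an isomorphism on a control system. -/
instance : SMul (SystemIso n m p) (ControlSystem n m p) where
  smul ψ sys :=
    { A := ψ.P.1.val * (sys.A - sys.B * (ψ.G⁻¹).val * ψ.F) * (ψ.P⁻¹).1.val
      B := ψ.P.1.val * sys.B * (ψ.G⁻¹).val
      C := ψ.S.1.val * sys.C * (ψ.P⁻¹).1.val
      isLift_A := by
        refine (IsLift.mul ψ.P.2 ?_).mul (ψ.P⁻¹).2
        have hA := sys.isLift_A
        unfold IsLift at *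
        rw [← hA]
        ext j
        simp [Matrix.mul_assoc, Matrix.mul_apply, sys.lastRow_B]
      lastRow_B := by
        have hP : ψ.P.1.val (Sum.inr ()) = Pi.single (Sum.inr ()) 1 := ψ.P.2
        ext j
        rw [Matrix.mul_assoc, Matrix.mul_apply, hP]
        simp [Pi.single_apply, Matrix.mul_apply, sys.lastRow_B]
      isLift_C := (IsLift.mul ψ.S.2 sys.isLift_C).mul (ψ.P⁻¹).2 }

theorem smul_A (ψ : SystemIso n m p) (sys : ControlSystem n m p) : (ψ • sys).A =
    ψ.P.1.val * (sys.A - sys.B * (ψ.G⁻¹).val * ψ.F) * (ψ.P⁻¹).1.val := rfl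

theorem smul_B (ψ : SystemIso n m p) (sys : ControlSystem n m p) :
    (ψ • sys).B = ψ.P.1.val * sys.B * (ψ.G⁻¹).val := rfl

theorem smul_C (ψ : SystemIso n m p) (sys : ControlSystem n m p) :
    (ψ • sys).C = ψ.S.1.val * sys.C * (ψ.P⁻¹).1.val := rfl

instance : MulAction (SystemIso n m p) (ControlSystem n m p) where
  one_smul sys := by
    ext1
    · simp [smul_A, one_def]
    · simp [smul_B, one_def]
    · simp [smul_C, one_def]
  mul_smul a b sys := by
    have h : b.P.1.val * (b.P⁻¹).1.val = 1 := (b.P : GL (Lift n) ℝ).mul_inv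
    have hP : ((a * b).P⁻¹).1.val = (b.P⁻¹).1.val * (a.P⁻¹).1.val := by
      simp [mul_def]
    have hP' : (a * b).P.1.val = a.P.1.val * b.P.1.val := rfl
    have hS' : (a * b).S.1.val = a.S.1.val * b.S.1.val := rfl
    have hF : (a * b).F = a.G.val * b.F + a.F * b.P.1.val := rfl
    have hG : ((a * b).G⁻¹).val = (b.G⁻¹).val * (a.G⁻¹).val := by
      simp [mul_def]
    have hg : (a.G⁻¹).val * a.G.val = 1 := a.G.inv_mul
    ext1
    · rw [smul_A, smul_A, smul_A, smul_B, hP, hP', hF, hG]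
      have e1 : sys.B * ((b.G⁻¹).val * (a.G⁻¹).val) * (a.G.val * b.F + a.F * b.P.1.val) =
          sys.B * (b.G⁻¹).val * b.F + sys.B * (b.G⁻¹).val * (a.G⁻¹).val * a.F * b.P.1.val := by
        rw [Matrix.mul_add]
        congr 1
        · calc _ = sys.B * (b.G⁻¹).val * ((a.G⁻¹).val * a.G.val) * b.F := by
                simp only [Matrix.mul_assoc]
            _ = _ := by rw [hg, Matrix.mul_one]
        · simp only [Matrix.mul_assoc]
      rw [e1]
      have e2 : b.P.1.val * sys.B * (b.G⁻¹).val * (a.G⁻¹).val * a.F =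
          b.P.1.val * (sys.B * (b.G⁻¹).val * (a.G⁻¹).val * a.F * b.P.1.val) * (b.P⁻¹).1.val := by
        calc _ = b.P.1.val * (sys.B * (b.G⁻¹).val * (a.G⁻¹).val * a.F) *
              (b.P.1.val * (b.P⁻¹).1.val) := by
                rw [h, Matrix.mul_one]; simp only [Matrix.mul_assoc]
          _ = _ := by simp only [Matrix.mul_assoc]
      rw [e2, ← Matrix.sub_mul, ← Matrix.mul_sub, sub_sub]
      simp only [Matrix.mul_assoc]
    · rw [smul_B, smul_B, smul_B, hP', hG]
      simp only [Matrix.mul_assoc]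
    · rw [smul_C, smul_C, smul_C, hP, hS']
      simp only [Matrix.mul_assoc]

/-- The vector space of all quadruples of matrices of the sizes of `(P, F, G, S)`. -/
abbrev Ambient (n m p : ℕ) : Type :=
  (Lift n → Lift n → ℝ) × (Fin m → Lift n → ℝ) × (Fin m → Fin m → ℝ) × (Lift p → Lift p → ℝ)

/-- The matrix entries of an isomorphism. This identifies the group of isomorphisms with an open
subset of an affine subspace of `Ambient n m p`. -/
def entries (ψ : SystemIso n m p) : Ambient n m p :=
  (ψ.P.1.val, ψ.F, ψ.G.val, ψ.S.1.val)

/-- The usual topology on the group of isomorphisms, that of the matrix entries. -/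
instance : TopologicalSpace (SystemIso n m p) :=
  TopologicalSpace.induced entries inferInstance

end SystemIso

/-- The symmetry group of a control system. -/
def symmetryGroup {n m p : ℕ} (sys : ControlSystem n m p) : Subgroup (SystemIso n m p) :=
  MulAction.stabilizer (SystemIso n m p) sys

/-- A prime system: it is equivalent to a system in chain form, the lengths of whose chains are the
controllability indices. -/
def IsPrime {n m p : ℕ} (sys : ControlSystem n m p) : Prop :=
  ∃ ψ : SystemIso n m p, (ψ • sys).IsChainForm (ctrlIndex (ψ • sys).A (ψ • sys).B)

/-- The subgroup `K` of the group of isomorphisms has dimension `d` as a Lie group: with the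
topology and group structure of a subgroup, it is a (real, smooth) Lie group modelled on `ℝᵈ`, and
it is smoothly embedded in the space of matrix entries. -/
def HasLieDimension {n m p : ℕ} (K : Subgroup (SystemIso n m p)) (d : ℕ) : Prop :=
  ∃ _ : ChartedSpace (EuclideanSpace ℝ (Fin d)) K,
    LieGroup (𝓡 d) ∞ K ∧
    Manifold.IsSmoothEmbedding (𝓡 d) 𝓘(ℝ, SystemIso.Ambient n m p) ∞
      (fun ψ : K => SystemIso.entries (ψ : SystemIso n m p))

end PrimeSystem

end

/-! Although the action involves inverses, the stabilizer equations can be cleared of them: `P B G⁻¹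
= B` becomes `P B = B G`, `S C P⁻¹ = C` becomes `S C = C P`, and substituting `P B G⁻¹ = B` into the
first component leaves `P A - B F = A P`. These are affine in the entries (`mem_symmetryGroup_iff`).
Hence the symmetry group is the part of an affine subspace `1 + W` where three determinants are
nonzero, and one global chart makes it an embedded Lie group of dimension `dim W`
(`hasLieDimension_of_forall_mem_iff`).

It remains to compute `dim W`. Conjugation carries `W` for `Σ` to `W` for `ψ • Σ`, and the rank
increments are invariant because feedback changes `A` only modulo the image of `B`. So chain form
may be assumed (`finrank_symmetryAlgebra_smul`, `rankIncr_smul`).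

In chain form the output part `S` determines everything: the row of `P` at the `l`-th state of chain
`i` (counting from 0) is row `i` of `S C Aˡ`, and the rows of `F` and `G` continue this pattern at
the end of the chain. The one constraint left is that row `i` of `S C Aˡ B` vanishes for `l + 1 <
κᵢ`. Since input `j` reaches only output `j`, with delay `κⱼ`, this says `Sᵢⱼ = 0` whenever `κⱼ <
κᵢ`. The free parameters are the `Sᵢⱼ` with `κᵢ ≤ κⱼ` and the `m` output translations. As `r_l`
counts the chains of length at least `l`, the former number `∑ r_{κᵢ}`
(`ChainRows.finrank_symmetryAlgebra`, `ChainRows.rankIncr_eq`). -/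

namespace PrimeSystem

/-! ### Smoothness of matrix multiplication and inversion -/

section Smoothness

variable {X : Type*} [NormedAddCommGroup X] [NormedSpace ℝ X]
  {a b c : Type*} [Fintype a] [Fintype b] [Fintype c] {n : WithTop ℕ∞} {x : X}

theorem contDiff_matrix_mul {f : X → a → b → ℝ} {g : X → b → c → ℝ}
    (hf : ContDiff ℝ n f) (hg : ContDiff ℝ n g) :
    ContDiff ℝ n (fun x i j => (Matrix.of (f x) * Matrix.of (g x)) i j) := by
  refine contDiff_pi' fun i => contDiff_pi' fun j => ?_
  simp only [Matrix.mul_apply, Matrix.of_apply]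
  fun_prop

theorem contDiffAt_matrix_mul {f : X → a → b → ℝ} {g : X → b → c → ℝ}
    (hf : ContDiffAt ℝ n f x) (hg : ContDiffAt ℝ n g x) :
    ContDiffAt ℝ n
      (fun x i j => (Matrix.of (f x) * Matrix.of (g x)) i j) x := by
  refine contDiffAt_pi.2 fun i => contDiffAt_pi.2 fun j => ?_
  simp only [Matrix.mul_apply, Matrix.of_apply]
  fun_prop

variable [DecidableEq a]

theorem contDiff_det {f : X → a → a → ℝ} (hf : ContDiff ℝ n f) :
    ContDiff ℝ n (fun x => (Matrix.of (f x)).det) := by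
  simp only [Matrix.det_apply', Matrix.of_apply]
  fun_prop

/-- Each entry of the adjugate is the determinant of the matrix with one row replaced by a constant
vector. -/
theorem contDiff_adjugate {f : X → a → a → ℝ} (hf : ContDiff ℝ n f) :
    ContDiff ℝ n (fun x i j => (Matrix.of (f x)).adjugate i j) := by
  refine contDiff_pi' fun i => contDiff_pi' fun j => ?_
  simp only [Matrix.adjugate_apply]
  refine contDiff_det (f := fun x => (Matrix.of (f x)).updateRow j (Pi.single i 1)) ?_
  refine contDiff_pi' fun k => contDiff_pi' fun l => ?_
  by_cases h : k = j
  · subst h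
    simp only [Matrix.updateRow_self]
    fun_prop
  · simp only [Matrix.updateRow_ne h, Matrix.of_apply]
    fun_prop

theorem contDiffAt_matrix_inv {f : X → a → a → ℝ} (hf : ContDiff ℝ n f)
    (hx : (Matrix.of (f x)).det ≠ 0) :
    ContDiffAt ℝ n (fun x i j => (Matrix.of (f x))⁻¹ i j) x := by
  have h1 : ContDiffAt ℝ n (fun x => ((Matrix.of (f x)).det)⁻¹) x :=
    (contDiff_det hf).contDiffAt.inv hx
  have h2 := (contDiff_adjugate hf).contDiffAt (x := x)
  simp only [Matrix.inv_def, Ring.inverse_eq_inv']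
  exact h1.smul h2

end Smoothness

/-! ### The group of isomorphisms in terms of matrix entries -/

namespace SystemIso

variable {n m p : ℕ}

theorem det_P_ne_zero (ψ : SystemIso n m p) : (Matrix.of ψ.entries.1).det ≠ 0 :=
  (Matrix.GeneralLinearGroup.det ψ.P.1).ne_zero

theorem det_G_ne_zero (ψ : SystemIso n m p) : (Matrix.of ψ.entries.2.2.1).det ≠ 0 :=
  (Matrix.GeneralLinearGroup.det ψ.G).ne_zero

theorem det_S_ne_zero (ψ : SystemIso n m p) : (Matrix.of ψ.entries.2.2.2).det ≠ 0 :=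
  (Matrix.GeneralLinearGroup.det ψ.S.1).ne_zero

theorem entries_injective : Function.Injective (entries : SystemIso n m p → Ambient n m p) := by
  intro ψ φ h
  have h1 := congrArg Prod.fst h
  have h2 := congrArg (fun w => w.2.1) h
  have h3 := congrArg (fun w => w.2.2.1) h
  have h4 := congrArg (fun w => w.2.2.2) h
  ext1
  · exact Subtype.ext (Units.ext h1)
  · exact h2
  · exact Units.ext h3
  · exact Subtype.ext (Units.ext h4)

/-- The composition of isomorphisms in terms of their entries. -/
def ambientMul (w₂ w₁ : Ambient n m p) : Ambient n m p :=
  ((Matrix.of w₂.1 * Matrix.of w₁.1 : Matrix _ _ ℝ),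
    (Matrix.of w₂.2.2.1 * Matrix.of w₁.2.1 + Matrix.of w₂.2.1 * Matrix.of w₁.1 : Matrix _ _ ℝ),
    (Matrix.of w₂.2.2.1 * Matrix.of w₁.2.2.1 : Matrix _ _ ℝ),
    (Matrix.of w₂.2.2.2 * Matrix.of w₁.2.2.2 : Matrix _ _ ℝ))

/-- The inversion of isomorphisms in terms of their entries. -/
noncomputable def ambientInv (w : Ambient n m p) : Ambient n m p :=
  (((Matrix.of w.1)⁻¹ : Matrix _ _ ℝ),
    (-((Matrix.of w.2.2.1)⁻¹ * Matrix.of w.2.1 * (Matrix.of w.1)⁻¹) : Matrix _ _ ℝ),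
    ((Matrix.of w.2.2.1)⁻¹ : Matrix _ _ ℝ), ((Matrix.of w.2.2.2)⁻¹ : Matrix _ _ ℝ))

theorem entries_inv (ψ : SystemIso n m p) : (ψ⁻¹).entries = ambientInv ψ.entries := by
  have hP : (ψ.P⁻¹).1.val = (Matrix.of ψ.entries.1)⁻¹ := Matrix.coe_units_inv ψ.P.1
  have hG : (ψ.G⁻¹).val = (Matrix.of ψ.entries.2.2.1)⁻¹ := Matrix.coe_units_inv ψ.G
  have hS : (ψ.S⁻¹).1.val = (Matrix.of ψ.entries.2.2.2)⁻¹ := Matrix.coe_units_inv ψ.S.1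
  simp only [inv_def]
  unfold ambientInv
  rw [← hP, ← hG, ← hS]
  rfl

theorem contDiff_ambientMul {k : WithTop ℕ∞} :
    ContDiff ℝ k (fun w : Ambient n m p × Ambient n m p => ambientMul w.1 w.2) := by
  have hP₁ : ContDiff ℝ k (fun w : Ambient n m p × Ambient n m p => w.2.1) := by fun_prop
  have hP₂ : ContDiff ℝ k (fun w : Ambient n m p × Ambient n m p => w.1.1) := by fun_prop
  have hF₁ : ContDiff ℝ k (fun w : Ambient n m p × Ambient n m p => w.2.2.1) := by fun_prop
  have hF₂ : ContDiff ℝ k (fun w : Ambient n m p × Ambient n m p => w.1.2.1) := by fun_prop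
  have hG₁ : ContDiff ℝ k (fun w : Ambient n m p × Ambient n m p => w.2.2.2.1) := by fun_prop
  have hG₂ : ContDiff ℝ k (fun w : Ambient n m p × Ambient n m p => w.1.2.2.1) := by fun_prop
  have hS₁ : ContDiff ℝ k (fun w : Ambient n m p × Ambient n m p => w.2.2.2.2) := by fun_prop
  have hS₂ : ContDiff ℝ k (fun w : Ambient n m p × Ambient n m p => w.1.2.2.2) := by fun_prop
  exact (contDiff_matrix_mul hP₂ hP₁).prodMk (((contDiff_matrix_mul hG₂ hF₁).add
    (contDiff_matrix_mul hF₂ hP₁)).prodMk ((contDiff_matrix_mul hG₂ hG₁).prodMk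
    (contDiff_matrix_mul hS₂ hS₁)))

theorem contDiffAt_ambientInv {k : WithTop ℕ∞} (ψ : SystemIso n m p) :
    ContDiffAt ℝ k (ambientInv : Ambient n m p → Ambient n m p) ψ.entries := by
  have hP := contDiffAt_matrix_inv (n := k) (f := fun w : Ambient n m p => w.1) (by fun_prop)
    ψ.det_P_ne_zero
  have hG := contDiffAt_matrix_inv (n := k) (f := fun w : Ambient n m p => w.2.2.1) (by fun_prop)
    ψ.det_G_ne_zero
  have hS := contDiffAt_matrix_inv (n := k) (f := fun w : Ambient n m p => w.2.2.2) (by fun_prop)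
    ψ.det_S_ne_zero
  have hF : ContDiff ℝ k (fun w : Ambient n m p => w.2.1) := by fun_prop
  have hGF := contDiffAt_matrix_mul hG hF.contDiffAt
  exact hP.prodMk ((contDiffAt_matrix_mul hGF hP).neg.prodMk
    (hG.prodMk hS))

theorem exists_entries_eq {w : Ambient n m p} (hP : IsLift (Matrix.of w.1))
    (hS : IsLift (Matrix.of w.2.2.2)) (hP' : (Matrix.of w.1).det ≠ 0)
    (hG' : (Matrix.of w.2.2.1).det ≠ 0) (hS' : (Matrix.of w.2.2.2).det ≠ 0) :
    ∃ ψ : SystemIso n m p, ψ.entries = w :=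
  ⟨⟨⟨Matrix.GeneralLinearGroup.mkOfDetNeZero _ hP', hP⟩, w.2.1,
    Matrix.GeneralLinearGroup.mkOfDetNeZero _ hG',
    ⟨Matrix.GeneralLinearGroup.mkOfDetNeZero _ hS', hS⟩⟩, rfl⟩

end SystemIso

open SystemIso

/-! ### Subgroups cut out by affine equations are Lie groups -/

open Topology in
/-- A subgroup which is cut out of the group of isomorphisms by affine equations on the matrix
entries is a Lie group, whose dimension is that of the direction of the affine subspace. -/
theorem hasLieDimension_of_forall_mem_iff {n m p d : ℕ} {K : Subgroup (SystemIso n m p)}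
    (W : Submodule ℝ (Ambient n m p)) (hd : Module.finrank ℝ W = d)
    (hP : ∀ w ∈ W, w.1 (Sum.inr ()) = 0) (hS : ∀ w ∈ W, w.2.2.2 (Sum.inr ()) = 0)
    (hK : ∀ ψ : SystemIso n m p, ψ ∈ K ↔ ψ.entries - (1 : SystemIso n m p).entries ∈ W) :
    HasLieDimension K d := by
  obtain ⟨l⟩ : Nonempty (EuclideanSpace ℝ (Fin d) ≃ₗ[ℝ] W) :=
    FiniteDimensional.nonempty_linearEquiv_of_finrank_eq (by simp [hd])
  let ι₀ : EuclideanSpace ℝ (Fin d) →ₗ[ℝ] Ambient n m p := W.subtype ∘ₗ l.toLinearMap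
  have hι₀ : ι₀.ker = ⊥ := LinearMap.ker_eq_bot.2 (W.subtype_injective.comp l.injective)
  -- Any linear retraction onto `W` will do: it supplies the global chart, and its kernel serves as
  -- the complement in the immersion.
  obtain ⟨π₀, hπ₀⟩ := LinearMap.exists_leftInverse_of_injective ι₀ hι₀
  let ι : EuclideanSpace ℝ (Fin d) →L[ℝ] Ambient n m p := ι₀.toContinuousLinearMap
  let π : Ambient n m p →L[ℝ] EuclideanSpace ℝ (Fin d) := π₀.toContinuousLinearMap
  have hπι : ∀ x, π (ι x) = x := fun x => LinearMap.congr_fun hπ₀ x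
  have hιW : ∀ x, ι x ∈ W := fun x => (l x).2
  have hWι : ∀ w ∈ W, ι (π w) = w := by
    intro w hw
    have : w = ι (l.symm ⟨w, hw⟩) := by
      change w = ((l (l.symm ⟨w, hw⟩) : W) : Ambient n m p)
      rw [l.apply_symm_apply]
    rw [this, hπι]
  let w₁ : Ambient n m p := (1 : SystemIso n m p).entries
  let val : K → Ambient n m p := fun ψ => entries (ψ : SystemIso n m p)
  have hval : IsEmbedding val :=
    ⟨⟨by rw [instTopologicalSpaceSubtype]; change _ = TopologicalSpace.induced (entries ∘ Subtype.val) _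
         rw [← induced_compose]; rfl⟩, entries_injective.comp Subtype.val_injective⟩
  let f : K → EuclideanSpace ℝ (Fin d) := fun ψ => π (val ψ - w₁)
  have hf : ∀ ψ, ι (f ψ) + w₁ = val ψ := fun ψ => by
    rw [hWι _ ((hK _).1 ψ.2)]; exact sub_add_cancel _ _
  have hfcont : Continuous f := π.continuous.comp (hval.continuous.sub continuous_const)
  have hfemb : IsEmbedding f := by
    -- Composing `f` with `x ↦ ι x + w₁` gives back the embedding `val`.
    refine IsEmbedding.of_comp hfcont (g := fun x => ι x + w₁)
      (ι.continuous.add continuous_const) ?_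
    convert hval using 1
    exact funext hf
  -- Elements of `W` have zero last rows in the `P` and `S` parts, so every point of `w₁ + W` has
  -- the last rows of a lift; only invertibility remains, and it is an open condition.
  have hrange : Set.range f = {x | (Matrix.of (ι x + w₁).1).det ≠ 0 ∧
      (Matrix.of (ι x + w₁).2.2.1).det ≠ 0 ∧ (Matrix.of (ι x + w₁).2.2.2).det ≠ 0} := by
    ext x
    constructor
    · rintro ⟨ψ, rfl⟩
      change _ ∧ _ ∧ _
      rw [hf]
      exact ⟨det_P_ne_zero _, det_G_ne_zero _, det_S_ne_zero _⟩
    · rintro ⟨h1, h2, h3⟩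
      have hP1 : IsLift (Matrix.of (ι x + w₁).1) := by
        have : (ι x + w₁).1 (Sum.inr ()) = (ι x).1 (Sum.inr ()) + w₁.1 (Sum.inr ()) := rfl
        rw [hP _ (hιW x), zero_add] at this
        exact this.trans (1 : SystemIso n m p).P.2
      have hS1 : IsLift (Matrix.of (ι x + w₁).2.2.2) := by
        have : (ι x + w₁).2.2.2 (Sum.inr ()) = (ι x).2.2.2 (Sum.inr ()) + w₁.2.2.2 (Sum.inr ()) :=
          rfl
        rw [hS _ (hιW x), zero_add] at this
        exact this.trans (1 : SystemIso n m p).S.2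
      obtain ⟨ψ, hψ⟩ := exists_entries_eq hP1 hS1 h1 h2 h3
      have hψ' : ψ.entries - w₁ = ι x := by rw [hψ, add_sub_cancel_right]
      refine ⟨⟨ψ, (hK ψ).2 (hψ' ▸ hιW x)⟩, ?_⟩
      change π (ψ.entries - w₁) = x
      rw [hψ', hπι]
  have hfopen : IsOpenEmbedding f := by
    refine ⟨hfemb, ?_⟩
    rw [hrange]
    have hc : Continuous (fun x => ι x + w₁) := ι.continuous.add continuous_const
    refine (isOpen_ne_fun (Continuous.matrix_det ?_) continuous_const).inter
      ((isOpen_ne_fun (Continuous.matrix_det ?_) continuous_const).inter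
      (isOpen_ne_fun (Continuous.matrix_det ?_) continuous_const))
    · exact hc.fst
    · exact hc.snd.snd.fst
    · exact hc.snd.snd.snd
  let _ : ChartedSpace (EuclideanSpace ℝ (Fin d)) K := hfopen.singletonChartedSpace
  have : IsManifold (𝓡 d) ∞ K := hfopen.isManifold_singleton
  have hfsmooth : ContMDiff (𝓡 d) (𝓡 d) ∞ f := contMDiff_isOpenEmbedding hfopen
  have hvalsmooth : ContMDiff (𝓡 d) 𝓘(ℝ, Ambient n m p) ∞ val := by
    have h : ContMDiff (𝓡 d) 𝓘(ℝ, Ambient n m p) ∞ (fun x => ι x + w₁) :=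
      (ι.contDiff.add contDiff_const).contMDiff
    convert h.comp hfsmooth using 1
    exact (funext hf).symm
  -- The chart extends to a smooth map on the whole ambient space, so smoothness of a map into `K`
  -- can be checked on matrix entries.
  have hproj : ContMDiff 𝓘(ℝ, Ambient n m p) (𝓡 d) ∞ (fun w => π (w - w₁)) :=
    (π.contDiff.comp (contDiff_id.sub contDiff_const)).contMDiff
  refine ⟨inferInstance, ?_, ?_, hval⟩
  · refine { contMDiff_mul := ?_, contMDiff_inv := ?_ }
    · apply ContMDiff.of_comp_isOpenEmbedding hfopen
      refine hproj.comp (f := fun x : K × K => val (x.1 * x.2)) ?_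
      have h : ContMDiff ((𝓡 d).prod (𝓡 d)) 𝓘(ℝ, Ambient n m p × Ambient n m p) ∞
          (fun x : K × K => (val x.1, val x.2)) :=
        (hvalsmooth.comp contMDiff_fst).prodMk_space (hvalsmooth.comp contMDiff_snd)
      exact contDiff_ambientMul.contMDiff.comp h
    · apply ContMDiff.of_comp_isOpenEmbedding hfopen
      refine hproj.comp (f := fun x : K => val x⁻¹) ?_
      have : (fun x : K => val x⁻¹) = ambientInv ∘ val := funext fun x => entries_inv x.1
      rw [this]
      exact fun x => ContMDiffAt.comp x (contDiffAt_ambientInv x.1).contMDiffAt (hvalsmooth x)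
  -- In the chart `f` on `K` and translation by `w₁` on the ambient space, `val` becomes the linear
  -- inclusion `ι`, which is the first factor of the splitting into the image of `ι` and the kernel
  -- of `π`.
  · refine Manifold.IsImmersionOfComplement.isImmersion (F := π.ker) fun x => ?_
    let e : (EuclideanSpace ℝ (Fin d) × π.ker) ≃L[ℝ] Ambient n m p :=
      (ContinuousLinearEquiv.equivOfRightInverse π ι hπι).symm
    let τ : Ambient n m p ≃ₜ Ambient n m p := Homeomorph.subRight w₁
    refine Manifold.IsImmersionAtOfComplement.mk_of_charts e (chartAt _ x)
      τ.toOpenPartialHomeomorph (mem_chart_source _ x) trivial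
      (IsManifold.chart_mem_maximalAtlas x) ?_ (fun _ _ => trivial) ?_
    · refine StructureGroupoid.mem_maximalAtlas_of_mem_groupoid _ ?_
      rw [contDiffGroupoid, mem_groupoid_of_pregroupoid]
      constructor
      · exact (contDiff_id.sub contDiff_const).contDiffOn
      · exact (contDiff_id.add contDiff_const).contDiffOn
    · intro y hy
      have hy' : y ∈ Set.range f := by
        have := (chartAt (EuclideanSpace ℝ (Fin d)) x).extend_target (I := 𝓡 d) ▸ hy
        have h2 := this.1
        change y ∈ (hfopen.toOpenPartialHomeomorph f).target at h2
        simpa using h2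
      obtain ⟨ψ, rfl⟩ := hy'
      have h1 : ((chartAt (EuclideanSpace ℝ (Fin d)) x).extend (𝓡 d)).symm (f ψ) = ψ :=
        hfopen.toOpenPartialHomeomorph_left_inv
      change val (((chartAt (EuclideanSpace ℝ (Fin d)) x).extend (𝓡 d)).symm (f ψ)) - w₁ =
        e (f ψ, 0)
      rw [h1, ← hf ψ]
      simp [e]

/-! ### The linearized symmetry equations -/

theorem mul_GL_inv_eq_iff {a b : Type*} [Fintype b] [DecidableEq b] {M N : Matrix a b ℝ}
    (g : GL b ℝ) : M * (g⁻¹).val = N ↔ M = N * g.val := by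
  constructor
  · rintro rfl
    rw [Matrix.mul_assoc, g.inv_mul, Matrix.mul_one]
  · rintro rfl
    rw [Matrix.mul_assoc, g.mul_inv, Matrix.mul_one]

variable {n m p : ℕ}

/-- The equations on the matrix entries which define the symmetries of a system are affine. This is
the space of solutions of the corresponding homogeneous linear equations, that is, the Lie algebra
of the symmetry group. -/
def symmetryAlgebra (sys : ControlSystem n m p) : Submodule ℝ (Ambient n m p) where
  carrier := {w | w.1 (Sum.inr ()) = 0 ∧ w.2.2.2 (Sum.inr ()) = 0 ∧
    Matrix.of w.1 * sys.A - sys.B * Matrix.of w.2.1 = sys.A * Matrix.of w.1 ∧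
    Matrix.of w.1 * sys.B = sys.B * Matrix.of w.2.2.1 ∧
    Matrix.of w.2.2.2 * sys.C = sys.C * Matrix.of w.1}
  zero_mem' := by
    refine ⟨rfl, rfl, ?_, ?_, ?_⟩ <;> simp
  add_mem' := by
    rintro w v ⟨h1, h2, h3, h4, h5⟩ ⟨k1, k2, k3, k4, k5⟩
    refine ⟨?_, ?_, ?_, ?_, ?_⟩
    · rw [Prod.fst_add, Pi.add_apply, h1, k1, add_zero]
    · simp only [Prod.snd_add, Pi.add_apply, h2, k2, add_zero]
    · simp only [Prod.fst_add, Prod.snd_add, ← Matrix.of_add_of, Matrix.add_mul, Matrix.mul_add,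
        ← h3, ← k3]
      abel
    · simp only [Prod.fst_add, Prod.snd_add, ← Matrix.of_add_of, Matrix.add_mul, Matrix.mul_add,
        h4, k4]
    · simp only [Prod.fst_add, Prod.snd_add, ← Matrix.of_add_of, Matrix.add_mul, Matrix.mul_add,
        h5, k5]
  smul_mem' := by
    rintro c w ⟨h1, h2, h3, h4, h5⟩
    refine ⟨?_, ?_, ?_, ?_, ?_⟩
    · rw [Prod.smul_fst, Pi.smul_apply, h1, smul_zero]
    · simp only [Prod.smul_snd, Pi.smul_apply, h2, smul_zero]
    · simp only [Prod.smul_fst, Prod.smul_snd, ← Matrix.smul_of, Matrix.smul_mul, Matrix.mul_smul,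
        ← h3, smul_sub]
    · simp only [Prod.smul_fst, Prod.smul_snd, ← Matrix.smul_of, Matrix.smul_mul, Matrix.mul_smul,
        h4]
    · simp only [Prod.smul_fst, Prod.smul_snd, ← Matrix.smul_of, Matrix.smul_mul, Matrix.mul_smul,
        h5]

theorem mem_symmetryAlgebra {sys : ControlSystem n m p} {w : Ambient n m p} :
    w ∈ symmetryAlgebra sys ↔ w.1 (Sum.inr ()) = 0 ∧ w.2.2.2 (Sum.inr ()) = 0 ∧
      Matrix.of w.1 * sys.A - sys.B * Matrix.of w.2.1 = sys.A * Matrix.of w.1 ∧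
      Matrix.of w.1 * sys.B = sys.B * Matrix.of w.2.2.1 ∧
      Matrix.of w.2.2.2 * sys.C = sys.C * Matrix.of w.1 := Iff.rfl

theorem mem_symmetryGroup_iff {sys : ControlSystem n m p} {ψ : SystemIso n m p} :
    ψ ∈ symmetryGroup sys ↔
      ψ.entries - (1 : SystemIso n m p).entries ∈ symmetryAlgebra sys := by
  have hP : ψ.P.1.val (Sum.inr ()) - (1 : Matrix (Lift n) (Lift n) ℝ) (Sum.inr ()) = 0 := by
    rw [show ψ.P.1.val (Sum.inr ()) = _ from ψ.P.2, isLift_one n, sub_self]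
  have hS : ψ.S.1.val (Sum.inr ()) - (1 : Matrix (Lift p) (Lift p) ℝ) (Sum.inr ()) = 0 := by
    rw [show ψ.S.1.val (Sum.inr ()) = _ from ψ.S.2, isLift_one p, sub_self]
  have hmem : ψ.entries - (1 : SystemIso n m p).entries ∈ symmetryAlgebra sys ↔
      (ψ.P.1.val - 1) * sys.A - sys.B * (ψ.F - 0) = sys.A * (ψ.P.1.val - 1) ∧
      (ψ.P.1.val - 1) * sys.B = sys.B * (ψ.G.val - 1) ∧
      (ψ.S.1.val - 1) * sys.C = sys.C * (ψ.P.1.val - 1) :=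
    ⟨fun h => h.2.2, fun h => ⟨hP, hS, h⟩⟩
  have hB : ψ.P.1.val * sys.B * (ψ.G⁻¹).val = sys.B ↔ ψ.P.1.val * sys.B = sys.B * ψ.G.val :=
    mul_GL_inv_eq_iff _
  have hC : ψ.S.1.val * sys.C * (ψ.P⁻¹).1.val = sys.C ↔ ψ.S.1.val * sys.C = sys.C * ψ.P.1.val :=
    mul_GL_inv_eq_iff ψ.P.1
  have hA : ψ.P.1.val * (sys.A - sys.B * (ψ.G⁻¹).val * ψ.F) * (ψ.P⁻¹).1.val = sys.A ↔
      ψ.P.1.val * (sys.A - sys.B * (ψ.G⁻¹).val * ψ.F) = sys.A * ψ.P.1.val :=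
    mul_GL_inv_eq_iff ψ.P.1
  have hstab : ψ ∈ symmetryGroup sys ↔ ψ • sys = sys := MulAction.mem_stabilizer_iff
  rw [hmem, hstab, ControlSystem.ext_iff, smul_A, smul_B, smul_C, hA, hB, hC]
  simp only [Matrix.sub_mul, Matrix.mul_sub, Matrix.one_mul, Matrix.mul_one, sub_zero,
    sub_left_inj, ← Matrix.mul_assoc]
  rw [show ψ.P.1.val * sys.A - sys.A - sys.B * ψ.F = ψ.P.1.val * sys.A - sys.B * ψ.F - sys.A by
    abel, sub_left_inj]
  -- The two forms of the `A`-equation agree only modulo the `B`-equation, which turns `P B G⁻¹ F`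
  -- into `B F`.
  refine and_congr_left fun h => ?_
  rw [← hB] at h
  rw [h.1]

/-! ### Invariance of the dimension under isomorphism -/

/-- Conjugation by an isomorphism, extended to quadruples of matrices. -/
def conjAmbient (ψ : SystemIso n m p) : Ambient n m p →ₗ[ℝ] Ambient n m p where
  -- This is `ψ (1 + w) ψ⁻¹ - 1` for the composition law of isomorphisms extended to matrix
  -- quadruples; the constant contributions of `ψ.F` cancel, leaving an expression linear in `w`.
  toFun w := ((ψ.P.1.val * Matrix.of w.1 * (ψ.P⁻¹).1.val : Matrix _ _ ℝ),
    ((ψ.G.val * Matrix.of w.2.1 + ψ.F * Matrix.of w.1 -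
      ψ.G.val * Matrix.of w.2.2.1 * (ψ.G⁻¹).val * ψ.F) * (ψ.P⁻¹).1.val : Matrix _ _ ℝ),
    (ψ.G.val * Matrix.of w.2.2.1 * (ψ.G⁻¹).val : Matrix _ _ ℝ),
    (ψ.S.1.val * Matrix.of w.2.2.2 * (ψ.S⁻¹).1.val : Matrix _ _ ℝ))
  map_add' w v := by
    have h : ∀ {a b c d : Type} [Fintype b] [Fintype c] (M : Matrix a b ℝ) (N : Matrix c d ℝ)
        (X Y : b → c → ℝ), M * Matrix.of (X + Y) * N = M * Matrix.of X * N + M * Matrix.of Y * N :=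
      fun M N X Y => by rw [← Matrix.of_add_of, Matrix.mul_add, Matrix.add_mul]
    refine Prod.ext (h _ _ _ _) (Prod.ext ?_ (Prod.ext (h _ _ _ _) (h _ _ _ _)))
    change (ψ.G.val * (Matrix.of w.2.1 + Matrix.of v.2.1) +
        ψ.F * (Matrix.of w.1 + Matrix.of v.1) -
        ψ.G.val * (Matrix.of w.2.2.1 + Matrix.of v.2.2.1) * (ψ.G⁻¹).val * ψ.F) * (ψ.P⁻¹).1.val =
      (ψ.G.val * Matrix.of w.2.1 + ψ.F * Matrix.of w.1 -
        ψ.G.val * Matrix.of w.2.2.1 * (ψ.G⁻¹).val * ψ.F) * (ψ.P⁻¹).1.val +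
      (ψ.G.val * Matrix.of v.2.1 + ψ.F * Matrix.of v.1 -
        ψ.G.val * Matrix.of v.2.2.1 * (ψ.G⁻¹).val * ψ.F) * (ψ.P⁻¹).1.val
    simp only [Matrix.mul_add, Matrix.add_mul, Matrix.sub_mul]
    abel
  map_smul' c w := by
    have h : ∀ {a b e d : Type} [Fintype b] [Fintype e] (M : Matrix a b ℝ) (N : Matrix e d ℝ)
        (X : b → e → ℝ), M * Matrix.of (c • X) * N = c • (M * Matrix.of X * N) :=
      fun M N X => by rw [← Matrix.smul_of, Matrix.mul_smul, Matrix.smul_mul]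
    refine Prod.ext (h _ _ _) (Prod.ext ?_ (Prod.ext (h _ _ _) (h _ _ _)))
    change (ψ.G.val * (c • Matrix.of w.2.1) + ψ.F * (c • Matrix.of w.1) -
        ψ.G.val * (c • Matrix.of w.2.2.1) * (ψ.G⁻¹).val * ψ.F) * (ψ.P⁻¹).1.val =
      c • ((ψ.G.val * Matrix.of w.2.1 + ψ.F * Matrix.of w.1 -
        ψ.G.val * Matrix.of w.2.2.1 * (ψ.G⁻¹).val * ψ.F) * (ψ.P⁻¹).1.val)
    simp only [Matrix.mul_smul, Matrix.smul_mul, ← smul_add, ← smul_sub]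

theorem conjAmbient_injective (ψ : SystemIso n m p) : Function.Injective (conjAmbient ψ) := by
  rw [← LinearMap.ker_eq_bot, LinearMap.ker_eq_bot']
  intro w hw
  have key : ∀ {a b : Type} [Fintype a] [DecidableEq a] [Fintype b] [DecidableEq b]
      (g : GL a ℝ) (h : GL b ℝ) (M : Matrix a b ℝ), g.val * M * (h⁻¹).val = 0 → M = 0 := by
    intro a b _ _ _ _ g h M hM
    rw [mul_GL_inv_eq_iff, Matrix.zero_mul] at hM
    calc M = (g⁻¹).val * (g.val * M) := by
          rw [← Matrix.mul_assoc, g.inv_mul, Matrix.one_mul]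
      _ = 0 := by rw [hM, Matrix.mul_zero]
  have h1 : Matrix.of w.1 = 0 := key ψ.P.1 ψ.P.1 _ (congrArg Prod.fst hw)
  have h3 : Matrix.of w.2.2.1 = 0 := key ψ.G ψ.G _ (congrArg (fun w => w.2.2.1) hw)
  have h4 : Matrix.of w.2.2.2 = 0 := key ψ.S.1 ψ.S.1 _ (congrArg (fun w => w.2.2.2) hw)
  have h2' : (ψ.G.val * Matrix.of w.2.1 + ψ.F * Matrix.of w.1 -
      ψ.G.val * Matrix.of w.2.2.1 * (ψ.G⁻¹).val * ψ.F) * (ψ.P⁻¹).1.val = 0 :=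
    congrArg (fun w => w.2.1) hw
  -- The `F`-component is triangular: once the `P` and `G` parts vanish, only two-sided
  -- multiplication by invertible matrices is left.
  rw [h1, h3] at h2'
  simp only [Matrix.mul_zero, Matrix.zero_mul, add_zero, sub_zero] at h2'
  have h2 : Matrix.of w.2.1 = 0 := key ψ.G ψ.P.1 _ h2'
  exact Prod.ext h1 (Prod.ext h2 (Prod.ext h3 h4))

/-- Infinitesimal version of the fact that conjugation by `ψ` takes the stabilizer of a system to
the stabilizer of its image. -/
theorem conjAmbient_mem {sys : ControlSystem n m p} (ψ : SystemIso n m p) {w : Ambient n m p}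
    (hw : w ∈ symmetryAlgebra sys) : conjAmbient ψ w ∈ symmetryAlgebra (ψ • sys) := by
  obtain ⟨h1, h2, h3, h4, h5⟩ := hw
  have hPP : (ψ.P⁻¹).1.val * ψ.P.1.val = 1 := (ψ.P : GL (Lift n) ℝ).inv_mul
  have hSS : (ψ.S⁻¹).1.val * ψ.S.1.val = 1 := (ψ.S : GL (Lift p) ℝ).inv_mul
  have hGG : (ψ.G⁻¹).val * ψ.G.val = 1 := ψ.G.inv_mul
  have row : ∀ {k : ℕ} (M N : Matrix (Lift k) (Lift k) ℝ) (W : Lift k → Lift k → ℝ), IsLift M →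
      W (Sum.inr ()) = 0 → (M * Matrix.of W * N) (Sum.inr ()) = 0 := by
    intro k M N W hM hW
    ext j
    unfold IsLift at hM
    rw [Matrix.mul_assoc, Matrix.mul_apply, hM]
    simp [Pi.single_apply, Matrix.mul_apply, hW]
  have cP : ∀ {a : Type} (X : Matrix (Lift n) a ℝ), (ψ.P⁻¹).1.val * (ψ.P.1.val * X) = X := by
    intro a X; rw [← Matrix.mul_assoc, hPP, Matrix.one_mul]
  have cS : ∀ {a : Type} (X : Matrix (Lift p) a ℝ), (ψ.S⁻¹).1.val * (ψ.S.1.val * X) = X := by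
    intro a X; rw [← Matrix.mul_assoc, hSS, Matrix.one_mul]
  have cG : ∀ {a : Type} (X : Matrix (Fin m) a ℝ), (ψ.G⁻¹).val * (ψ.G.val * X) = X := by
    intro a X; rw [← Matrix.mul_assoc, hGG, Matrix.one_mul]
  -- The defining equations are restated with a trailing factor `X`, so that they apply inside
  -- right-associated products and push `w` past `A`, `B` and `C`.
  have h4' : ∀ {a : Type} (X : Matrix (Fin m) a ℝ), Matrix.of w.1 * (sys.B * X) =
      sys.B * (Matrix.of w.2.2.1 * X) := by
    intro a X; rw [← Matrix.mul_assoc, h4, Matrix.mul_assoc]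
  have h3' : ∀ {a : Type} (X : Matrix (Lift n) a ℝ), Matrix.of w.1 * (sys.A * X) =
      sys.A * (Matrix.of w.1 * X) + sys.B * (Matrix.of w.2.1 * X) := by
    intro a X
    rw [← Matrix.mul_assoc, ← Matrix.mul_assoc, ← h3]
    simp only [Matrix.sub_mul, Matrix.mul_assoc, sub_add_cancel]
  have h5' : ∀ {a : Type} (X : Matrix (Lift n) a ℝ), Matrix.of w.2.2.2 * (sys.C * X) =
      sys.C * (Matrix.of w.1 * X) := by
    intro a X; rw [← Matrix.mul_assoc, h5, Matrix.mul_assoc]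
  refine ⟨row _ _ _ ψ.P.2 h1, row _ _ _ ψ.S.2 h2, ?_, ?_, ?_⟩
  · change ψ.P.1.val * Matrix.of w.1 * (ψ.P⁻¹).1.val *
      (ψ.P.1.val * (sys.A - sys.B * (ψ.G⁻¹).val * ψ.F) * (ψ.P⁻¹).1.val) -
      ψ.P.1.val * sys.B * (ψ.G⁻¹).val * ((ψ.G.val * Matrix.of w.2.1 + ψ.F * Matrix.of w.1 -
        ψ.G.val * Matrix.of w.2.2.1 * (ψ.G⁻¹).val * ψ.F) * (ψ.P⁻¹).1.val) =
      ψ.P.1.val * (sys.A - sys.B * (ψ.G⁻¹).val * ψ.F) * (ψ.P⁻¹).1.val *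
        (ψ.P.1.val * Matrix.of w.1 * (ψ.P⁻¹).1.val)
    simp only [Matrix.mul_assoc, Matrix.sub_mul, Matrix.mul_sub, Matrix.add_mul, Matrix.mul_add,
      cP, cG, h3', h4']
    abel
  · change ψ.P.1.val * Matrix.of w.1 * (ψ.P⁻¹).1.val * (ψ.P.1.val * sys.B * (ψ.G⁻¹).val) =
      ψ.P.1.val * sys.B * (ψ.G⁻¹).val * (ψ.G.val * Matrix.of w.2.2.1 * (ψ.G⁻¹).val)
    simp only [Matrix.mul_assoc, cP, cG, h4']
  · change ψ.S.1.val * Matrix.of w.2.2.2 * (ψ.S⁻¹).1.val *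
      (ψ.S.1.val * sys.C * (ψ.P⁻¹).1.val) =
      ψ.S.1.val * sys.C * (ψ.P⁻¹).1.val * (ψ.P.1.val * Matrix.of w.1 * (ψ.P⁻¹).1.val)
    simp only [Matrix.mul_assoc, cP, cS, h5']

theorem finrank_symmetryAlgebra_smul (ψ : SystemIso n m p) (sys : ControlSystem n m p) :
    Module.finrank ℝ (symmetryAlgebra (ψ • sys)) = Module.finrank ℝ (symmetryAlgebra sys) := by
  have key : ∀ (ψ : SystemIso n m p) (sys : ControlSystem n m p),
      Module.finrank ℝ (symmetryAlgebra sys) ≤ Module.finrank ℝ (symmetryAlgebra (ψ • sys)) :=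
    fun ψ sys => LinearMap.finrank_le_finrank_of_injective
      (f := (conjAmbient ψ).restrict fun _ hw => conjAmbient_mem ψ hw)
      fun x y h => Subtype.ext (conjAmbient_injective ψ (congrArg Subtype.val h))
  refine le_antisymm ?_ (key ψ sys)
  -- The reverse inequality is the same one applied to the inverse isomorphism.
  have h := key ψ⁻¹ (ψ • sys)
  rwa [inv_smul_smul] at h

/-- The dimension of the symmetry group is that of the space of solutions of the homogeneous linear
equations. -/
theorem hasLieDimension_symmetryGroup (sys : ControlSystem n m p) :
    HasLieDimension (symmetryGroup sys) (Module.finrank ℝ (symmetryAlgebra sys)) :=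
  hasLieDimension_of_forall_mem_iff (symmetryAlgebra sys) rfl (fun _ hw => hw.1)
    (fun _ hw => hw.2.1) fun _ => mem_symmetryGroup_iff

/-! ### Reachability ranks and their invariance -/

section Reach

variable {N : Type} [Fintype N] [DecidableEq N] {m : ℕ}

theorem range_reachMatrix_zero (A : Matrix N N ℝ) (B : Matrix N (Fin m) ℝ) :
    (reachMatrix A B 0).mulVecLin.range = B.mulVecLin.range := by
  rw [Matrix.range_mulVecLin, Matrix.range_mulVecLin]
  congr 1
  ext v
  constructor
  · rintro ⟨⟨k, u⟩, rfl⟩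
    refine ⟨u, ?_⟩
    ext a
    simp [reachMatrix, Matrix.col]
  · rintro ⟨u, rfl⟩
    refine ⟨(0, u), ?_⟩
    ext a
    simp [reachMatrix, Matrix.col]

/-- This recursion for the reachable subspaces exposes `A` only modulo the image of `B`, which is
what makes feedback invariance provable by induction. -/
theorem range_reachMatrix_succ (A : Matrix N N ℝ) (B : Matrix N (Fin m) ℝ) (j : ℕ) :
    (reachMatrix A B (j + 1)).mulVecLin.range =
      B.mulVecLin.range ⊔ (reachMatrix A B j).mulVecLin.range.map A.mulVecLin := by
  simp only [Matrix.range_mulVecLin, Submodule.map_span, ← Submodule.span_union]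
  congr 1
  have hsucc : ∀ (k : Fin (j + 1)) (u : Fin m), (reachMatrix A B (j + 1)).col (k.succ, u) =
      A.mulVecLin ((reachMatrix A B j).col (k, u)) := by
    intro k u
    ext a
    simp only [reachMatrix, Matrix.col, Matrix.of_apply, Matrix.transpose_apply, Fin.val_succ,
      pow_succ', Matrix.mul_assoc, Matrix.mulVecLin_apply]
    rfl
  have hzero : ∀ u : Fin m, (reachMatrix A B (j + 1)).col (0, u) = B.col u := by
    intro u
    ext a
    simp [reachMatrix, Matrix.col]
  ext v
  constructor
  · rintro ⟨⟨k, u⟩, rfl⟩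
    refine Fin.cases ?_ (fun k => ?_) k
    · exact Or.inl ⟨u, (hzero u).symm⟩
    · exact Or.inr ⟨_, ⟨(k, u), rfl⟩, (hsucc k u).symm⟩
  · rintro (⟨u, rfl⟩ | ⟨_, ⟨⟨k, u⟩, rfl⟩, rfl⟩)
    · exact ⟨(0, u), hzero u⟩
    · exact ⟨(k.succ, u), hsucc k u⟩

omit [DecidableEq N] in
-- The feedback term `B F v` lies in the image of `B`. The converse inclusion follows by undoing the
-- feedback with `-F`.
theorem range_sup_map_sub_mul (A : Matrix N N ℝ) (B : Matrix N (Fin m) ℝ)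
    (F : Matrix (Fin m) N ℝ) (V : Submodule ℝ (N → ℝ)) :
    B.mulVecLin.range ⊔ V.map (A - B * F).mulVecLin = B.mulVecLin.range ⊔ V.map A.mulVecLin := by
  have key : ∀ (A : Matrix N N ℝ) (F : Matrix (Fin m) N ℝ),
      B.mulVecLin.range ⊔ V.map (A - B * F).mulVecLin ≤
        B.mulVecLin.range ⊔ V.map A.mulVecLin := by
    intro A F
    refine sup_le le_sup_left ?_
    rintro _ ⟨v, hv, rfl⟩
    have : (A - B * F).mulVecLin v = B.mulVecLin (-(F *ᵥ v)) + A.mulVecLin v := by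
      simp only [Matrix.mulVecLin_apply, Matrix.sub_mulVec, ← Matrix.mulVec_mulVec,
        Matrix.mulVec_neg]
      abel
    rw [this]
    exact Submodule.add_mem_sup ⟨_, rfl⟩ ⟨v, hv, rfl⟩
  refine le_antisymm (key A F) ?_
  have h := key (A - B * F) (-F)
  rwa [Matrix.mul_neg, sub_neg_eq_add, sub_add_cancel] at h

end Reach

theorem range_reachMatrix_smul (ψ : SystemIso n m p) (sys : ControlSystem n m p) (j : ℕ) :
    (reachMatrix (ψ • sys).A (ψ • sys).B j).mulVecLin.range =
      (reachMatrix sys.A sys.B j).mulVecLin.range.map ψ.P.1.val.mulVecLin := by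
  have hPP : (ψ.P⁻¹).1.val * ψ.P.1.val = 1 := (ψ.P : GL (Lift n) ℝ).inv_mul
  have hB : (ψ • sys).B.mulVecLin.range = sys.B.mulVecLin.range.map ψ.P.1.val.mulVecLin := by
    rw [smul_B, Matrix.mulVecLin_mul, Matrix.mulVecLin_mul, LinearMap.range_comp_of_range_eq_top,
      LinearMap.range_comp]
    refine LinearMap.range_eq_top.2 fun v => ⟨ψ.G.val *ᵥ v, ?_⟩
    rw [Matrix.mulVecLin_apply, Matrix.mulVec_mulVec, ψ.G.inv_mul, Matrix.one_mulVec]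
  induction j with
  | zero => rw [range_reachMatrix_zero, range_reachMatrix_zero, hB]
  | succ j ih =>
    rw [range_reachMatrix_succ, range_reachMatrix_succ, ih, hB, ← Submodule.map_comp,
      ← Matrix.mulVecLin_mul, smul_A, Matrix.mul_assoc _ _ ψ.P.1.val, hPP, Matrix.mul_one,
      Matrix.mulVecLin_mul, Submodule.map_comp, ← Submodule.map_sup, Matrix.mul_assoc sys.B,
      range_sup_map_sub_mul]

theorem rank_reachMatrix_smul (ψ : SystemIso n m p) (sys : ControlSystem n m p) (j : ℕ) :
    (reachMatrix (ψ • sys).A (ψ • sys).B j).rank = (reachMatrix sys.A sys.B j).rank := by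
  have hinj : Function.Injective ψ.P.1.val.mulVecLin := by
    intro v w h
    have h2 := congrArg ((ψ.P⁻¹).1.val *ᵥ ·) h
    have hPP : (ψ.P⁻¹).1.val * ψ.P.1.val = 1 := (ψ.P : GL (Lift n) ℝ).inv_mul
    simpa only [Matrix.mulVecLin_apply, Matrix.mulVec_mulVec, hPP, Matrix.one_mulVec] using h2
  rw [Matrix.rank, Matrix.rank, range_reachMatrix_smul]
  exact (Submodule.equivMapOfInjective _ hinj _).finrank_eq.symm

theorem rank_eq_rank_reachMatrix_zero {N : Type} [Fintype N] [DecidableEq N] (A : Matrix N N ℝ)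
    (B : Matrix N (Fin m) ℝ) : B.rank = (reachMatrix A B 0).rank := by
  rw [Matrix.rank, Matrix.rank, range_reachMatrix_zero]

theorem rankIncr_smul (ψ : SystemIso n m p) (sys : ControlSystem n m p) :
    rankIncr (ψ • sys).A (ψ • sys).B = rankIncr sys.A sys.B := by
  funext j
  match j with
  | 0 => rfl
  | 1 =>
    change (ψ • sys).B.rank = sys.B.rank
    rw [rank_eq_rank_reachMatrix_zero (ψ • sys).A, rank_eq_rank_reachMatrix_zero sys.A,
      rank_reachMatrix_smul]
  | j + 2 =>
    change Matrix.rank _ - Matrix.rank _ = Matrix.rank _ - Matrix.rank _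
    rw [rank_reachMatrix_smul, rank_reachMatrix_smul]

theorem ctrlIndex_smul (ψ : SystemIso n m p) (sys : ControlSystem n m p) :
    ctrlIndex (ψ • sys).A (ψ • sys).B = ctrlIndex sys.A sys.B := by
  funext i
  unfold ctrlIndex
  rw [rankIncr_smul]

/-! ### Systems in chain form and their rank increments -/

/-- The index of the `j`-th state of the `i`-th chain. -/
def chainState {n m : ℕ} {κ : Fin m → ℕ} (hn : ∑ i, κ i = n) :
    (Σ i : Fin m, Fin (κ i)) ≃ Fin n :=
  finSigmaFinEquiv.trans (finCongr hn)

/-- The rows of the products with the matrices of a system in chain form. -/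
structure ChainRows {n m : ℕ} (sys : ControlSystem n m m) {κ : Fin m → ℕ} (hn : ∑ i, κ i = n) :
    Prop where
  pos : ∀ i, 0 < κ i
  pow_A : ∀ {b : Type} (k : ℕ) (X : Matrix (Lift n) b ℝ) (i : Fin m) (j : Fin (κ i)),
    (sys.A ^ k * X) (Sum.inl (chainState hn ⟨i, j⟩)) =
      if h : (j : ℕ) + k < κ i then X (Sum.inl (chainState hn ⟨i, ⟨j + k, h⟩⟩)) else 0
  pow_A_inr : ∀ {b : Type} (k : ℕ) (X : Matrix (Lift n) b ℝ),
    (sys.A ^ k * X) (Sum.inr ()) = X (Sum.inr ())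
  B : ∀ {b : Type} (X : Matrix (Fin m) b ℝ) (i : Fin m) (j : Fin (κ i)),
    (sys.B * X) (Sum.inl (chainState hn ⟨i, j⟩)) = if (j : ℕ) + 1 < κ i then 0 else X i
  B_inr : ∀ {b : Type} (X : Matrix (Fin m) b ℝ), (sys.B * X) (Sum.inr ()) = 0
  C : ∀ {b : Type} (X : Matrix (Lift n) b ℝ) (i : Fin m),
    (sys.C * X) (Sum.inl i) = X (Sum.inl (chainState hn ⟨i, ⟨0, pos i⟩⟩))
  C_inr : ∀ {b : Type} (X : Matrix (Lift n) b ℝ), (sys.C * X) (Sum.inr ()) = X (Sum.inr ())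

theorem IsLift.mul_inr {k n : ℕ} {b : Type} {M : Matrix (Lift k) (Lift n) ℝ} (hM : IsLift M)
    (X : Matrix (Lift n) b ℝ) : (M * X) (Sum.inr ()) = X (Sum.inr ()) := by
  ext j
  unfold IsLift at hM
  rw [Matrix.mul_apply, hM]
  simp [Pi.single_apply]

/-- The chain form prescribes `A` and `C` only on vectors with last coordinate 1; since these span,
the prescription extends linearly to all vectors. -/
theorem eq_liftVec_add {n : ℕ} (v : Lift n → ℝ) :
    v = liftVec (fun a => v (Sum.inl a)) + (v (Sum.inr ()) - 1) • liftVec 0 := by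
  ext (a | a) <;> simp [liftVec]

theorem ControlSystem.IsChainForm.chainRows {n m : ℕ} {sys : ControlSystem n m m} {κ : Fin m → ℕ}
    (h : sys.IsChainForm κ) : ∃ hn : ∑ i, κ i = n, ChainRows sys hn := by
  obtain ⟨hp, hn, hκ, hAB, hC⟩ := h
  refine ⟨hn, ?_⟩
  change ∀ (x : Fin n → ℝ) (u : Fin m → ℝ) (i : Fin m) (j : Fin (κ i)),
    (sys.A *ᵥ liftVec x + sys.B *ᵥ u) (Sum.inl (chainState hn ⟨i, j⟩)) =
      if h : (j : ℕ) + 1 < κ i then x (chainState hn ⟨i, ⟨j + 1, h⟩⟩) else u i at hAB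
  change ∀ (x : Fin n → ℝ) (i : Fin m),
    (sys.C *ᵥ liftVec x) (Sum.inl i) = x (chainState hn ⟨i, ⟨0, hκ i⟩⟩) at hC
  have hA0 : ∀ (x : Fin n → ℝ) (i : Fin m) (j : Fin (κ i)),
      (sys.A *ᵥ liftVec x) (Sum.inl (chainState hn ⟨i, j⟩)) =
        if h : (j : ℕ) + 1 < κ i then x (chainState hn ⟨i, ⟨j + 1, h⟩⟩) else 0 := by
    intro x i j
    simpa using hAB x 0 i j
  have hA : ∀ {b : Type} (X : Matrix (Lift n) b ℝ) (i : Fin m) (j : Fin (κ i)),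
      (sys.A * X) (Sum.inl (chainState hn ⟨i, j⟩)) =
        if h : (j : ℕ) + 1 < κ i then X (Sum.inl (chainState hn ⟨i, ⟨j + 1, h⟩⟩)) else 0 := by
    intro b X i j
    ext c
    change (sys.A *ᵥ fun a => X a c) (Sum.inl (chainState hn ⟨i, j⟩)) = _
    rw [eq_liftVec_add (fun a => X a c), Matrix.mulVec_add, Matrix.mulVec_smul, Pi.add_apply,
      Pi.smul_apply, hA0, hA0]
    split_ifs <;> simp
  have hpow : ∀ {b : Type} (k : ℕ) (X : Matrix (Lift n) b ℝ) (i : Fin m) (j : Fin (κ i)),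
      (sys.A ^ k * X) (Sum.inl (chainState hn ⟨i, j⟩)) =
        if h : (j : ℕ) + k < κ i then X (Sum.inl (chainState hn ⟨i, ⟨j + k, h⟩⟩)) else 0 := by
    intro b k
    induction k with
    | zero => intro X i j; simp
    | succ k ih =>
      intro X i j
      rw [pow_succ, Matrix.mul_assoc, ih]
      by_cases h1 : (j : ℕ) + k < κ i
      · rw [dif_pos h1, hA]
        simp only [add_assoc]
      · rw [dif_neg h1, dif_neg (by omega)]
  refine ⟨hκ, hpow, ?_, ?_, ?_, ?_, sys.isLift_C.mul_inr⟩
  · intro b k X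
    induction k with
    | zero => simp
    | succ k ih => rw [pow_succ', Matrix.mul_assoc, sys.isLift_A.mul_inr, ih]
  · intro b X i j
    ext c
    have h0 := hAB 0 (fun a => X a c) i j
    rw [Pi.add_apply, hA0] at h0
    simp only [Pi.zero_apply, dite_eq_ite, ite_self, zero_add] at h0
    change (sys.B *ᵥ fun a => X a c) (Sum.inl (chainState hn ⟨i, j⟩)) = _
    rw [h0]
    split_ifs <;> rfl
  · intro b X
    ext c
    rw [Matrix.mul_apply, sys.lastRow_B]
    simp
  · intro b X i
    ext c
    change (sys.C *ᵥ fun a => X a c) (Sum.inl i) = _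
    rw [eq_liftVec_add (fun a => X a c), Matrix.mulVec_add, Matrix.mulVec_smul, Pi.add_apply,
      Pi.smul_apply, hC, hC]
    simp

namespace ChainRows

variable {n m : ℕ} {sys : ControlSystem n m m} {κ : Fin m → ℕ} {hn : ∑ i, κ i = n}

/-- Input `u` enters at the last state of chain `u` and each application of `A` moves it one place
towards the output, until it leaves the chain. -/
theorem pow_A_mul_B (h : ChainRows sys hn) (k : ℕ) (i : Fin m) (j : Fin (κ i)) (u : Fin m) :
    (sys.A ^ k * sys.B) (Sum.inl (chainState hn ⟨i, j⟩)) u =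
      if (j : ℕ) + k + 1 = κ i ∧ i = u then 1 else 0 := by
  have hB := h.B (1 : Matrix (Fin m) (Fin m) ℝ)
  rw [Matrix.mul_one] at hB
  rw [h.pow_A]
  by_cases h1 : (j : ℕ) + k < κ i
  · rw [dif_pos h1, hB]
    by_cases h2 : (j : ℕ) + k + 1 < κ i
    · rw [if_pos h2, if_neg (by omega), Pi.zero_apply]
    · rw [if_neg h2, Matrix.one_apply]
      simp only [show (j : ℕ) + k + 1 = κ i by omega, true_and]
  · rw [dif_neg h1, if_neg (by omega), Pi.zero_apply]

theorem pow_A_mul_B_inr (h : ChainRows sys hn) (k : ℕ) :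
    (sys.A ^ k * sys.B) (Sum.inr ()) = 0 := by
  rw [h.pow_A_inr, sys.lastRow_B]

/-- Column of `AᵏB` as a basis vector. -/
theorem col_pow_A_mul_B (h : ChainRows sys hn) {k : ℕ} {u : Fin m} (hk : k < κ u) :
    (sys.A ^ k * sys.B).col u =
      Pi.single (Sum.inl (chainState hn ⟨u, ⟨κ u - 1 - k, by omega⟩⟩)) 1 := by
  ext (a | a)
  · obtain ⟨⟨i, j⟩, rfl⟩ := (chainState hn).surjective a
    change (sys.A ^ k * sys.B) _ _ = _
    rw [h.pow_A_mul_B, Pi.single_apply]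
    congr 1
    simp only [Sum.inl.injEq, EmbeddingLike.apply_eq_iff_eq, eq_iff_iff]
    constructor
    · rintro ⟨h1, rfl⟩
      congr 1
      ext
      simp only
      omega
    · intro h1
      obtain ⟨rfl, h2⟩ := Sigma.mk.inj h1
      rw [heq_iff_eq, Fin.ext_iff] at h2
      simp only at h2
      exact ⟨by omega, rfl⟩
  · change (sys.A ^ k * sys.B) _ _ = _
    rw [show (Sum.inr a : Lift n) = Sum.inr () from rfl, h.pow_A_mul_B_inr]
    simp

theorem col_pow_A_mul_B_eq_zero (h : ChainRows sys hn) {k : ℕ} {u : Fin m} (hk : κ u ≤ k) :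
    (sys.A ^ k * sys.B).col u = 0 := by
  ext (a | a)
  · obtain ⟨⟨i, j⟩, rfl⟩ := (chainState hn).surjective a
    change (sys.A ^ k * sys.B) _ _ = _
    rw [h.pow_A_mul_B, if_neg, Pi.zero_apply]
    rintro ⟨h1, rfl⟩
    omega
  · change (sys.A ^ k * sys.B) _ _ = _
    rw [show (Sum.inr a : Lift n) = Sum.inr () from rfl, h.pow_A_mul_B_inr]
    simp

/-- The nonzero columns are distinct standard basis vectors, and chain `u` contributes its last `min
(κ u) (J + 1)` states. -/
theorem rank_reachMatrix (h : ChainRows sys hn) (J : ℕ) :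
    (reachMatrix sys.A sys.B J).rank = ∑ u, min (κ u) (J + 1) := by
  let g : (Σ u : Fin m, Fin (min (κ u) (J + 1))) → Lift n := fun q =>
    Sum.inl (chainState hn ⟨q.1, ⟨κ q.1 - 1 - q.2, by have := q.2.2; omega⟩⟩)
  have hg : Function.Injective g := by
    rintro ⟨u, k⟩ ⟨v, l⟩ hq
    have h1 := (chainState hn).injective (Sum.inl.inj hq)
    obtain ⟨rfl, h2⟩ := Sigma.mk.inj h1
    rw [heq_iff_eq, Fin.ext_iff] at h2
    simp only at h2
    congr 1
    ext
    have hk : (k : ℕ) < min (κ u) (J + 1) := k.2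
    have hl : (l : ℕ) < min (κ u) (J + 1) := l.2
    omega
  have hspan : Submodule.span ℝ (Set.range (reachMatrix sys.A sys.B J).col) =
      Submodule.span ℝ (Set.range (Pi.basisFun ℝ (Lift n) ∘ g)) := by
    refine le_antisymm (Submodule.span_le.2 ?_) (Submodule.span_le.2 ?_)
    · rintro _ ⟨⟨k, u⟩, rfl⟩
      change (sys.A ^ (k : ℕ) * sys.B).col u ∈ _
      by_cases hk : (k : ℕ) < κ u
      · rw [h.col_pow_A_mul_B hk]
        refine Submodule.subset_span ⟨⟨u, ⟨k, by omega⟩⟩, ?_⟩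
        simp [g]
      · rw [h.col_pow_A_mul_B_eq_zero (by omega)]
        exact Submodule.zero_mem _
    · rintro _ ⟨⟨u, k⟩, rfl⟩
      have hk := k.2
      refine Submodule.subset_span ⟨(⟨k, by omega⟩, u), ?_⟩
      change (sys.A ^ (k : ℕ) * sys.B).col u = _
      rw [h.col_pow_A_mul_B (by omega)]
      simp [g]
  rw [Matrix.rank_eq_finrank_span_cols, hspan,
    finrank_span_eq_card ((Pi.basisFun ℝ (Lift n)).linearIndependent.comp g hg)]
  simp

/-- Passing from `l - 1` to `l` raises `min (κ u) _` by one exactly for the chains with `κ u ≥ l`.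
-/
theorem rankIncr_eq (h : ChainRows sys hn) {l : ℕ} (hl : 1 ≤ l) :
    rankIncr sys.A sys.B l = (Finset.univ.filter fun u => l ≤ κ u).card := by
  match l with
  | 1 =>
    change sys.B.rank = _
    rw [rank_eq_rank_reachMatrix_zero sys.A, h.rank_reachMatrix, Finset.card_filter]
    refine Finset.sum_congr rfl fun u _ => ?_
    have := h.pos u
    split_ifs <;> omega
  | l + 2 =>
    change Matrix.rank _ - Matrix.rank _ = _
    rw [h.rank_reachMatrix, h.rank_reachMatrix, Finset.card_filter, Nat.sub_eq_iff_eq_add',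
      ← Finset.sum_add_distrib]
    · refine Finset.sum_congr rfl fun u _ => ?_
      split_ifs <;> omega
    · exact Finset.sum_le_sum fun u _ => by omega

/-- Input `j` appears at output `j` alone, after a delay of exactly `κ j`, so `C Aˡ B` selects the
columns of `S` belonging to chains of length `l + 1`. -/
theorem mul_C_pow_A_mul_B (h : ChainRows sys hn) {b : Type} (S : Matrix b (Lift m) ℝ) (l : ℕ)
    (i : b) (j : Fin m) :
    (S * sys.C * sys.A ^ l * sys.B) i j = if l + 1 = κ j then S i (Sum.inl j) else 0 := by
  rw [Matrix.mul_assoc, Matrix.mul_assoc, Matrix.mul_apply, Fintype.sum_sum_type]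
  simp only [h.C, h.C_inr, h.pow_A_mul_B, h.pow_A_mul_B_inr, zero_add]
  by_cases h1 : l + 1 = κ j
  · rw [if_pos h1, Finset.sum_eq_single j]
    · simp [h1]
    · intro k _ hk
      simp [hk]
    · simp
  · rw [if_neg h1]
    simp only [Pi.zero_apply, mul_zero, Finset.sum_const_zero, add_zero]
    refine Finset.sum_eq_zero fun k _ => ?_
    rw [if_neg, mul_zero]
    rintro ⟨h2, rfl⟩
    exact h1 h2

/-! ### Infinitesimal symmetries of a chain form -/

section

variable {w : Ambient n m m}

/-- The equation `S C = C P` gives the row at the first state of a chain. At a state that is not the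
last, `B F` has zero row, so `P A - B F = A P` says that the next row is the current one times `A`.
-/
theorem P_row_eq (h : ChainRows sys hn) (hw : w ∈ symmetryAlgebra sys) (i : Fin m) (l : ℕ)
    (hl : l < κ i) : Matrix.of w.1 (Sum.inl (chainState hn ⟨i, ⟨l, hl⟩⟩)) =
      (Matrix.of w.2.2.2 * sys.C * sys.A ^ l) (Sum.inl i) := by
  obtain ⟨-, -, h3, -, h5⟩ := hw
  induction l with
  | zero => rw [pow_zero, Matrix.mul_one, h5, h.C]
  | succ l ih =>
    have h3' := congrFun h3 (Sum.inl (chainState hn ⟨i, ⟨l, by omega⟩⟩))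
    have hA := h.pow_A 1 (Matrix.of w.1) i ⟨l, by omega⟩
    rw [pow_one, dif_pos hl, ← h3'] at hA
    rw [← hA, pow_succ, ← Matrix.mul_assoc, Matrix.mul_apply_eq_vecMul _ sys.A, ← ih (by omega)]
    change (Matrix.of w.1 * sys.A) _ - (sys.B * Matrix.of w.2.1) _ = _
    rw [h.B, if_pos hl, sub_zero, Matrix.mul_apply_eq_vecMul]

/-- At the last state of a chain `A P` has zero row, so the row of `F` must equal that of `P A`. -/
theorem F_row_eq (h : ChainRows sys hn) (hw : w ∈ symmetryAlgebra sys) (i : Fin m) :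
    Matrix.of w.2.1 i = (Matrix.of w.2.2.2 * sys.C * sys.A ^ κ i) (Sum.inl i) := by
  have hκ := h.pos i
  have hP := h.P_row_eq hw i (κ i - 1) (by omega)
  obtain ⟨-, -, h3, -, -⟩ := hw
  have h3' := congrFun h3 (Sum.inl (chainState hn ⟨i, ⟨κ i - 1, by omega⟩⟩))
  have hA := h.pow_A 1 (Matrix.of w.1) i ⟨κ i - 1, by omega⟩
  have hlast : ¬ κ i - 1 + 1 < κ i := by omega
  rw [pow_one, dif_neg hlast, ← h3'] at hA
  change (Matrix.of w.1 * sys.A) _ - (sys.B * Matrix.of w.2.1) _ = _ at hA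
  rw [h.B, if_neg hlast, sub_eq_zero, Matrix.mul_apply_eq_vecMul, hP,
    ← Matrix.mul_apply_eq_vecMul, Matrix.mul_assoc _ (sys.A ^ _), ← pow_succ,
    show κ i - 1 + 1 = κ i by omega] at hA
  exact hA.symm

theorem G_row_eq (h : ChainRows sys hn) (hw : w ∈ symmetryAlgebra sys) (i : Fin m) :
    Matrix.of w.2.2.1 i =
      (Matrix.of w.2.2.2 * sys.C * sys.A ^ (κ i - 1) * sys.B) (Sum.inl i) := by
  have hκ := h.pos i
  have hP := h.P_row_eq hw i (κ i - 1) (by omega)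
  obtain ⟨-, -, -, h4, -⟩ := hw
  have h4' := congrFun h4 (Sum.inl (chainState hn ⟨i, ⟨κ i - 1, by omega⟩⟩))
  have hlast : ¬ κ i - 1 + 1 < κ i := by omega
  rw [h.B, if_neg hlast, Matrix.mul_apply_eq_vecMul, hP, ← Matrix.mul_apply_eq_vecMul] at h4'
  exact h4'.symm

/-- State number `κ j - 1` of chain `i`, counted from 0, is not the last one when `κ j < κ i`, so `B
G` has zero row there, whereas the `j`-th entry of that row of `P B` is `Sᵢⱼ`. -/
theorem S_apply_eq_zero (h : ChainRows sys hn) (hw : w ∈ symmetryAlgebra sys) {i j : Fin m}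
    (hij : κ j < κ i) : w.2.2.2 (Sum.inl i) (Sum.inl j) = 0 := by
  have hκ := h.pos j
  have hP := h.P_row_eq hw i (κ j - 1) (by omega)
  have h4' := congrFun hw.2.2.2.1 (Sum.inl (chainState hn ⟨i, ⟨κ j - 1, by omega⟩⟩))
  have hlt : κ j - 1 + 1 < κ i := by omega
  rw [h.B, if_pos hlt, Matrix.mul_apply_eq_vecMul, hP, ← Matrix.mul_apply_eq_vecMul] at h4'
  have h5 := congrFun h4' j
  rwa [h.mul_C_pow_A_mul_B, if_pos (by omega), Matrix.of_apply, Pi.zero_apply] at h5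

end

/-- The infinitesimal symmetry of a system in chain form with a given action on the outputs. -/
def symmetryOf (sys : ControlSystem n m m) {κ : Fin m → ℕ} (hn : ∑ i, κ i = n)
    (S : Matrix (Lift m) (Lift m) ℝ) : Ambient n m m :=
  (Sum.elim (fun a => (S * sys.C * sys.A ^ (((chainState hn).symm a).2 : ℕ))
      (Sum.inl ((chainState hn).symm a).1)) 0,
    fun i => (S * sys.C * sys.A ^ κ i) (Sum.inl i),
    fun i => (S * sys.C * sys.A ^ (κ i - 1) * sys.B) (Sum.inl i), S)

/-- The rows of `P`, `F` and `G` are chosen to solve the equations; the vanishing of `Sᵢⱼ` enters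
only for `P B = B G` at states that are not last in their chain. -/
theorem symmetryOf_mem (h : ChainRows sys hn) {S : Matrix (Lift m) (Lift m) ℝ}
    (hS : S (Sum.inr ()) = 0) (hS' : ∀ i j, κ j < κ i → S (Sum.inl i) (Sum.inl j) = 0) :
    symmetryOf sys hn S ∈ symmetryAlgebra sys := by
  have hP : ∀ (i : Fin m) (j : Fin (κ i)), Matrix.of (symmetryOf sys hn S).1
      (Sum.inl (chainState hn ⟨i, j⟩)) = (S * sys.C * sys.A ^ (j : ℕ)) (Sum.inl i) := by
    intro i j
    change (fun q : Σ i : Fin m, Fin (κ i) => (S * sys.C * sys.A ^ (q.2 : ℕ)) (Sum.inl q.1))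
      ((chainState hn).symm (chainState hn ⟨i, j⟩)) = _
    rw [Equiv.symm_apply_apply]
  have hP0 : Matrix.of (symmetryOf sys hn S).1 (Sum.inr ()) = 0 := rfl
  have hA := h.pow_A 1 (Matrix.of (symmetryOf sys hn S).1)
  have hAinr := h.pow_A_inr 1 (Matrix.of (symmetryOf sys hn S).1)
  rw [pow_one] at hAinr
  simp only [pow_one] at hA
  have hF : ∀ i, Matrix.of (symmetryOf sys hn S).2.1 i =
      (S * sys.C * sys.A ^ κ i) (Sum.inl i) := fun i => rfl
  have hG : ∀ i, Matrix.of (symmetryOf sys hn S).2.2.1 i =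
      (S * sys.C * sys.A ^ (κ i - 1) * sys.B) (Sum.inl i) := fun i => rfl
  refine mem_symmetryAlgebra.2 ⟨rfl, hS, ?_, ?_, ?_⟩
  · funext a
    change (Matrix.of (symmetryOf sys hn S).1 * sys.A) a -
      (sys.B * Matrix.of (symmetryOf sys hn S).2.1) a = _
    rcases a with a | a
    · obtain ⟨⟨i, j⟩, rfl⟩ := (chainState hn).surjective a
      rw [hA, h.B, Matrix.mul_apply_eq_vecMul, hP, ← Matrix.mul_apply_eq_vecMul,
        Matrix.mul_assoc _ (sys.A ^ _), ← pow_succ]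
      by_cases hj : (j : ℕ) + 1 < κ i
      · rw [if_pos hj, dif_pos hj, hP, sub_zero]
      · rw [if_neg hj, dif_neg hj, hF, show (j : ℕ) + 1 = κ i by omega, sub_self]
    · rw [show (Sum.inr a : Lift n) = Sum.inr () from rfl, hAinr, h.B_inr,
        Matrix.mul_apply_eq_vecMul, hP0, Matrix.zero_vecMul, sub_zero]
  · funext a
    rcases a with a | a
    · obtain ⟨⟨i, j⟩, rfl⟩ := (chainState hn).surjective a
      rw [h.B, Matrix.mul_apply_eq_vecMul, hP, ← Matrix.mul_apply_eq_vecMul]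
      by_cases hj : (j : ℕ) + 1 < κ i
      · rw [if_pos hj]
        funext u
        rw [h.mul_C_pow_A_mul_B]
        split_ifs with hu
        · exact hS' _ _ (by omega)
        · rfl
      · rw [if_neg hj, hG, show κ i - 1 = (j : ℕ) by omega]
    · rw [show (Sum.inr a : Lift n) = Sum.inr () from rfl, h.B_inr,
        Matrix.mul_apply_eq_vecMul, hP0, Matrix.zero_vecMul]
  · funext a
    change (S * sys.C) a = _
    rcases a with a | a
    · rw [h.C, hP, pow_zero, Matrix.mul_one]
    · rw [show (Sum.inr a : Lift m) = Sum.inr () from rfl, h.C_inr, hP0,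
        Matrix.mul_apply_eq_vecMul, hS, Matrix.zero_vecMul]

theorem eq_zero_of_S_eq_zero (h : ChainRows sys hn) {w : Ambient n m m}
    (hw : w ∈ symmetryAlgebra sys) (hS : Matrix.of w.2.2.2 = 0) : w = 0 := by
  refine Prod.ext (funext fun a => ?_) (Prod.ext (funext fun i => ?_)
    (Prod.ext (funext fun i => ?_) hS))
  · rcases a with a | a
    · obtain ⟨⟨i, j⟩, rfl⟩ := (chainState hn).surjective a
      refine (h.P_row_eq hw i j j.2).trans ?_
      rw [hS, Matrix.zero_mul, Matrix.zero_mul]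
      rfl
    · exact hw.1
  · refine (h.F_row_eq hw i).trans ?_
    rw [hS, Matrix.zero_mul, Matrix.zero_mul]
    rfl
  · refine (h.G_row_eq hw i).trans ?_
    rw [hS, Matrix.zero_mul, Matrix.zero_mul, Matrix.zero_mul]
    rfl

/-- The infinitesimal symmetries of a system in chain form are determined by the action on the
outputs, which does not mix a chain with the outputs of shorter chains. -/
theorem finrank_symmetryAlgebra (h : ChainRows sys hn) :
    Module.finrank ℝ (symmetryAlgebra sys) =
      ∑ i, (Finset.univ.filter fun j => κ i ≤ κ j).card + m := by
  -- Coordinates are the entries of `S` not forced to vanish: the pairs with `κ i ≤ κ j`, and the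
  -- translation column, which gives the summand `m`.
  let Φ : symmetryAlgebra sys →ₗ[ℝ]
      ((Σ i : Fin m, {j : Fin m // κ i ≤ κ j}) ⊕ Fin m → ℝ) :=
    { toFun := fun w => Sum.elim (fun q => w.1.2.2.2 (Sum.inl q.1) (Sum.inl q.2.1))
        (fun i => w.1.2.2.2 (Sum.inl i) (Sum.inr ()))
      map_add' := fun w v => by ext (q | i) <;> rfl
      map_smul' := fun c w => by ext (q | i) <;> rfl }
  have hinj : Function.Injective Φ := by
    rw [← LinearMap.ker_eq_bot, LinearMap.ker_eq_bot']
    rintro ⟨w, hw⟩ hΦ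
    refine Subtype.ext (h.eq_zero_of_S_eq_zero hw ?_)
    funext a b
    rcases a with i | a
    · rcases b with j | b
      · by_cases hij : κ i ≤ κ j
        · exact congrFun hΦ (Sum.inl ⟨i, j, hij⟩)
        · exact h.S_apply_eq_zero hw (not_le.1 hij)
      · exact congrFun hΦ (Sum.inr i)
    · exact congrFun hw.2.1 b
  have hsurj : Function.Surjective Φ := by
    intro θ
    let S : Matrix (Lift m) (Lift m) ℝ := Sum.elim (fun i => Sum.elim
      (fun j => if hij : κ i ≤ κ j then θ (Sum.inl ⟨i, j, hij⟩) else 0)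
      (fun _ => θ (Sum.inr i))) 0
    refine ⟨⟨symmetryOf sys hn S, h.symmetryOf_mem rfl fun i j hij => dif_neg (not_le.2 hij)⟩, ?_⟩
    ext (⟨i, j, hij⟩ | i)
    · exact dif_pos hij
    · rfl
  rw [(LinearEquiv.ofBijective Φ ⟨hinj, hsurj⟩).finrank_eq, Module.finrank_fintype_fun_eq_card]
  simp [Fintype.card_subtype]

end ChainRows

/-! ### The dimension formula -/

/-- Both sides are invariant under isomorphism, and in chain form the number of `j` with `κ i ≤ κ j`
is the rank increment at `κ i`; this uses `κ i ≥ 1`, but not the ordering of the indices. -/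
theorem finrank_symmetryAlgebra_of_isPrime {n m p : ℕ} {sys : ControlSystem n m p}
    (hsys : IsPrime sys) : Module.finrank ℝ (symmetryAlgebra sys) =
      ∑ i, rankIncr sys.A sys.B (ctrlIndex sys.A sys.B i) + m := by
  obtain ⟨ψ, hψ⟩ := hsys
  obtain rfl : m = p := hψ.1
  rw [← finrank_symmetryAlgebra_smul ψ sys, ← ctrlIndex_smul ψ sys, ← rankIncr_smul ψ sys]
  obtain ⟨hn, h⟩ := hψ.chainRows
  rw [h.finrank_symmetryAlgebra]
  congr 1
  exact Finset.sum_congr rfl fun i _ => (h.rankIncr_eq (h.pos i)).symm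

end PrimeSystem

theorem mainTheorem3 {n m p : ℕ} (sys : PrimeSystem.ControlSystem n m p)
    (hcontrollable : sys.IsControllable) (hobservable : sys.IsObservable)
    (hprime : PrimeSystem.IsPrime sys) :
    PrimeSystem.HasLieDimension (PrimeSystem.symmetryGroup sys)
      (∑ i : Fin m, PrimeSystem.rankIncr sys.A sys.B (PrimeSystem.ctrlIndex sys.A sys.B i) + m) := by
  rw [← PrimeSystem.finrank_symmetryAlgebra_of_isPrime hprime]
  exact PrimeSystem.hasLieDimension_symmetryGroup sys
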